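/- Let $\overline{\mathcal M}_{0,5}$ be the moduli space over $\mathbb C$ of stable genus $0$ curves with five marked points, identified with the space of configurations $(x_1,\dots,x_5)$ of points of $\mathbb P^1$, no three of which coincide, modulo $PGL_2(\mathbb C)$. Let $D_{i,j}\subset\overline{\mathcal M}_{0,5}$ be the boundary divisor where $x_i$ collides with $x_j$. All indices are modulo $5$. Put $$\mathcal M^{\rm cyc}_{0,5}:=\overline{\mathcal M}_{0,5}\setminus\bigcup_{c=1}^{5}D_{c,c+1}.$$ Let $\psi_1:\mathbb C^*\times\mathbb C^*\to\overline{\mathcal M}_{0,5}$ be the map $(X,Y)\mapsto(\infty,-1,0,X,X(1+Y))$, and let $\psi_c$ be obtained from $\psi_1$ by the cyclic shift of the labels of the five points by $2(c-1)$. Let $$r(x_1,x_2,x_3,x_4)=\frac{(x_1-x_2)(x_3-x_4)}{(x_1-x_4)(x_2-x_3)}.$$ For integers $a\le 0$, $b\ge 0$ and $c$ modulo $5$ let $X_{a,b;c}$ be the function $$X_{a,b;c}=r(x_c,x_{c+1},x_{c+2},x_{c+3})^a\, r(x_c,x_{c+2},x_{c+3},x_{c+4})^b$$ on $\mathcal M^{\rm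 cyc}_{0,5}$, where for $a<0$ the first factor is $0$ at the points at which $r(x_c,x_{c+1},x_{c+2},x_{c+3})=\infty$. (i) The maps $\psi_c$ are injective, their images are Zariski open in $\overline{\mathcal M}_{0,5}$, and $\mathcal M^{\rm cyc}_{0,5}$ is the union of the five open subsets $\psi_c(\mathbb C^*\times\mathbb C^*)$. (ii) The set of all functions $X_{a,b;c}$, with integers $a\le 0$, $b\ge 0$ and $c$ modulo $5$, is a basis of the complex vector space of regular functions on $\mathcal M^{\rm cyc}_{0,5}$. -/

import Mathlib

open scoped LinearAlgebra.Projectivization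

noncomputable section

namespace ModuliM05

/-! ### Points of the complex projective line -/

/-- The plane `ℂ²`; the vector `(z, w)` has ratio `z / w`. -/
abbrev V2 : Type := Fin 2 → ℂ

/-- The complex projective line. -/
abbrev P1 : Type := ℙ ℂ V2

/-- The point `z` of the affine line `ℂ ⊂ ℙ¹`. -/
def aff (z : ℂ) : P1 :=
  Projectivization.mk ℂ ![z, 1] (fun h => one_ne_zero (congrFun h 1))

/-- The point `∞` of `ℙ¹`. -/
def infty : P1 :=
  Projectivization.mk ℂ ![1, 0] (fun h => one_ne_zero (congrFun h 0))

theorem aff_injective : Function.Injective aff := by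
  intro z w h
  obtain ⟨a, ha⟩ := (Projectivization.mk_eq_mk_iff' ℂ _ _ _ _).1 h
  have h0 := congrFun ha 0
  have h1 := congrFun ha 1
  simp at h0 h1
  simp [← h0, h1]

theorem aff_ne_infty (z : ℂ) : aff z ≠ infty := by
  intro h
  obtain ⟨a, ha⟩ := (Projectivization.mk_eq_mk_iff' ℂ _ _ _ _).1 h
  have h1 := congrFun ha 1
  simp at h1

/-! ### The surface `M̄₀,₅` -/

/-- Five labelled points of `ℙ¹` (the labels are `1, 2, 3, 4, 5 = 0` modulo `5`) form a stable
configuration if no three of them coincide; two disjoint pairs of points may collide. -/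
def IsStable (x : ZMod 5 → P1) : Prop :=
  ∀ i j k : ZMod 5, i ≠ j → j ≠ k → i ≠ k → ¬ (x i = x j ∧ x j = x k)

/-- The stable configurations of five points of `ℙ¹`. -/
abbrev StableConf : Type := {x : ZMod 5 → P1 // IsStable x}

/-- Two configurations are equivalent if a projective transformation, i.e. an invertible linear
map of `ℂ²`, takes one to the other. -/
instance projEquiv : Setoid StableConf where
  r x y := ∃ g : LinearMap.GeneralLinearGroup ℂ V2, ∀ i, y.1 i = g • x.1 i
  iseqv :=
    { refl := fun x => ⟨1, fun i => (one_smul _ _).symm⟩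
      symm := by
        rintro x y ⟨g, hg⟩
        exact ⟨g⁻¹, fun i => by rw [hg, inv_smul_smul]⟩
      trans := by
        rintro x y z ⟨g, hg⟩ ⟨h, hh⟩
        exact ⟨h * g, fun i => by rw [hh, hg, mul_smul]⟩ }

/-- The complex points of the Deligne-Mumford-Knudsen moduli space `M̄₀,₅`, realized as the
geometric invariant theory quotient of the space of stable configurations in `(ℙ¹)⁵` by `PGL₂`
(for five points this quotient and `M̄₀,₅` are canonically isomorphic).
A stable curve of genus zero with five marked points has exactly one component onto which
its marked points project so that no three of them coincide; the projected points are the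
configuration. Conversely the stable curve is recovered by attaching a new line, which carries the
two marked points in question, at each point of `ℙ¹` where two points of the configuration
collide. -/
def Mbar : Type := Quotient projEquiv

/-- The point of `M̄₀,₅` given by a stable configuration. -/
def Mbar.mk (x : StableConf) : Mbar := Quotient.mk projEquiv x

/-- The boundary divisor `D_{i,j}`, where `x_i` collides with `x_j`. -/
def boundaryDivisor (i j : ZMod 5) : Set Mbar :=
  {m | ∃ x : StableConf, Mbar.mk x = m ∧ x.1 i = x.1 j}

/-- The surface `M^cyc₀,₅`: the complement in `M̄₀,₅` of the five divisors `D_{c,c+1}`,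
`c` modulo `5`. -/
def Mcyc : Set Mbar := Set.univ \ ⋃ c : ZMod 5, boundaryDivisor c (c + 1)

/-! ### Zariski topology and regular functions -/

/-- Homogeneous coordinates of stable configurations: five nonzero vectors of `ℂ²`, no three of
which are proportional. This is a Zariski open subset of `(ℂ²)⁵`. -/
structure HomCoord : Type where
  /-- The vector that represents the `i`-th point. -/
  vec : ZMod 5 → V2
  ne_zero : ∀ i, vec i ≠ 0
  stable : IsStable (fun i => Projectivization.mk ℂ (vec i) (ne_zero i))

/-- The point of `M̄₀,₅` with the given homogeneous coordinates. -/
def HomCoord.toMbar (v : HomCoord) : Mbar :=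
  Mbar.mk ⟨fun i => Projectivization.mk ℂ (v.vec i) (v.ne_zero i), v.stable⟩

/-- The polynomial functions on `(ℂ²)⁵`. -/
abbrev CoordPoly : Type := MvPolynomial (ZMod 5 × Fin 2) ℂ

/-- The value of a polynomial at the given homogeneous coordinates. -/
def HomCoord.eval (v : HomCoord) (p : CoordPoly) : ℂ :=
  MvPolynomial.eval (fun s => v.vec s.1 s.2) p

/-- The Zariski topology on the space of homogeneous coordinates. -/
instance zariskiHomCoord : TopologicalSpace HomCoord :=
  TopologicalSpace.generateFrom {s | ∃ p : CoordPoly, s = {v | v.eval p ≠ 0}}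

/-- The Zariski topology on `M̄₀,₅`: the quotient topology. -/
instance zariskiMbar : TopologicalSpace Mbar :=
  TopologicalSpace.coinduced HomCoord.toMbar zariskiHomCoord

/-- A complex valued function on an open subset `U` of `M̄₀,₅` is regular if it is, as a function
of the homogeneous coordinates of the configuration, locally a quotient of two polynomials with
nowhere vanishing denominator. -/
def IsRegularFun (U : Set Mbar) (f : U → ℂ) : Prop :=
  ∀ v : HomCoord, v.toMbar ∈ U → ∃ p q : CoordPoly, v.eval q ≠ 0 ∧
    ∀ (w : HomCoord) (hw : w.toMbar ∈ U), w.eval q ≠ 0 → f ⟨w.toMbar, hw⟩ = w.eval p / w.eval q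

/-- The algebra of regular functions on an open subset `U` of `M̄₀,₅`. -/
def regularFunctions (U : Set Mbar) : Subalgebra ℂ (U → ℂ) where
  carrier := {f | IsRegularFun U f}
  mul_mem' := by
    intro f g hf hg v hv
    obtain ⟨p, q, hq, h⟩ := hf v hv
    obtain ⟨p', q', hq', h'⟩ := hg v hv
    refine ⟨p * p', q * q', ?_, ?_⟩
    · simpa [HomCoord.eval] using ⟨hq, hq'⟩
    · intro w hw hne
      have hne' : w.eval q ≠ 0 ∧ w.eval q' ≠ 0 := by simpa [HomCoord.eval] using hne
      rw [Pi.mul_apply, h w hw hne'.1, h' w hw hne'.2]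
      simp only [HomCoord.eval, map_mul]
      rw [div_mul_div_comm]
  add_mem' := by
    intro f g hf hg v hv
    obtain ⟨p, q, hq, h⟩ := hf v hv
    obtain ⟨p', q', hq', h'⟩ := hg v hv
    refine ⟨p * q' + q * p', q * q', ?_, ?_⟩
    · simpa [HomCoord.eval] using ⟨hq, hq'⟩
    · intro w hw hne
      have hne' : w.eval q ≠ 0 ∧ w.eval q' ≠ 0 := by simpa [HomCoord.eval] using hne
      rw [Pi.add_apply, h w hw hne'.1, h' w hw hne'.2, div_add_div _ _ hne'.1 hne'.2]
      simp only [HomCoord.eval, map_mul, map_add]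
  algebraMap_mem' := by
    intro a v hv
    exact ⟨MvPolynomial.C a, 1, by simp [HomCoord.eval], fun w hw _ => by simp [HomCoord.eval]⟩

/-! ### The torus charts -/

/-- A configuration whose neighbours in the cyclic order are distinct is stable. -/
theorem isStable_of_cyclic {x : ZMod 5 → P1} (h : ∀ i, x i ≠ x (i + 1)) : IsStable x := by
  rintro i j k hij hjk hik ⟨h1, h2⟩
  have key : ∀ i j k : ZMod 5, i ≠ j → j ≠ k → i ≠ k →
      j = i + 1 ∨ i = j + 1 ∨ k = j + 1 ∨ j = k + 1 ∨ k = i + 1 ∨ i = k + 1 := by decide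
  rcases key i j k hij hjk hik with e | e | e | e | e | e
  · exact h i (by rw [← e, h1])
  · exact h j (by rw [← e, h1])
  · exact h j (by rw [← e, h2])
  · exact h k (by rw [← e, h2])
  · exact h i (by rw [← e, h1, h2])
  · exact h k (by rw [← e, h1, h2])

/-- The configuration `(x₁, x₂, x₃, x₄, x₅) = (∞, -1, 0, X, X(1+Y))`. The entry with index
`0 = 5` is listed first. -/
def baseConf (X Y : ℂˣ) : ZMod 5 → P1 :=
  ![aff (X * (1 + Y)), infty, aff (-1), aff 0, aff X]

theorem baseConf_cyclic (X Y : ℂˣ) (i : ZMod 5) : baseConf X Y i ≠ baseConf X Y (i + 1) := by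
  change Fin 5 at i
  fin_cases i
  · exact aff_ne_infty _
  · exact (aff_ne_infty _).symm
  · exact fun h => by simpa using aff_injective h
  · exact fun h => X.ne_zero (aff_injective h).symm
  · intro h
    have h' : (X : ℂ) = X * (1 + Y) := aff_injective h
    have : (X : ℂ) * Y = 0 := by linear_combination -h'
    simp at this

/-- The chart `ψ_c`, obtained from `ψ₁` by the cyclic shift of the configuration by `2(c - 1)`:
the point which has the label `i` in `ψ₁` gets the label `i + 2(c - 1)`. -/
def psi (c : ZMod 5) (t : ℂˣ × ℂˣ) : Mbar :=
  Mbar.mk ⟨fun i => baseConf t.1 t.2 (i - 2 * (c - 1)), isStable_of_cyclic fun i => by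
    have h := baseConf_cyclic t.1 t.2 (i - 2 * (c - 1))
    rwa [sub_add_eq_add_sub] at h⟩

/-! ### Cross-ratios -/

/-- The area `Δ(v, w)` of the parallelogram spanned by `v` and `w`. -/
def area (v w : V2) : ℂ := v 0 * w 1 - w 0 * v 1

theorem area_smul (a b : ℂ) (v w : V2) : area (a • v) (b • w) = a * b * area v w := by
  simp only [area, Pi.smul_apply, smul_eq_mul]
  ring

/-- The cross-ratio of four vectors. -/
def vecCrossRatio (v₁ v₂ v₃ v₄ : V2) : ℂ :=
  (area v₁ v₂ * area v₃ v₄) / (area v₁ v₄ * area v₂ v₃)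

theorem vecCrossRatio_smul {a b c d : ℂ} (ha : a ≠ 0) (hb : b ≠ 0) (hc : c ≠ 0) (hd : d ≠ 0)
    (v₁ v₂ v₃ v₄ : V2) :
    vecCrossRatio (a • v₁) (b • v₂) (c • v₃) (d • v₄) = vecCrossRatio v₁ v₂ v₃ v₄ := by
  simp only [vecCrossRatio, area_smul]
  rw [show a * b * area v₁ v₂ * (c * d * area v₃ v₄)
      = (a * b * c * d) * (area v₁ v₂ * area v₃ v₄) by ring,
    show a * d * area v₁ v₄ * (b * c * area v₂ v₃)
      = (a * b * c * d) * (area v₁ v₄ * area v₂ v₃) by ring]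
  exact mul_div_mul_left _ _ (by simp [ha, hb, hc, hd])

/-- The cross-ratio
`r(x₁, x₂, x₃, x₄) = (x₁ - x₂)(x₃ - x₄) / ((x₁ - x₄)(x₂ - x₃))`
of four points of `ℙ¹`, so that `r(∞, -1, 0, z) = z`; by convention it is `0` where the
denominator vanishes. -/
def crossRatio (x₁ x₂ x₃ x₄ : P1) : ℂ := vecCrossRatio x₁.rep x₂.rep x₃.rep x₄.rep

theorem crossRatio_mk {v₁ v₂ v₃ v₄ : V2} (h₁ : v₁ ≠ 0) (h₂ : v₂ ≠ 0) (h₃ : v₃ ≠ 0)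
    (h₄ : v₄ ≠ 0) :
    crossRatio (.mk ℂ v₁ h₁) (.mk ℂ v₂ h₂) (.mk ℂ v₃ h₃) (.mk ℂ v₄ h₄)
      = vecCrossRatio v₁ v₂ v₃ v₄ := by
  obtain ⟨a, ha⟩ := Projectivization.exists_smul_eq_mk_rep ℂ v₁ h₁
  obtain ⟨b, hb⟩ := Projectivization.exists_smul_eq_mk_rep ℂ v₂ h₂
  obtain ⟨c, hc⟩ := Projectivization.exists_smul_eq_mk_rep ℂ v₃ h₃
  obtain ⟨d, hd⟩ := Projectivization.exists_smul_eq_mk_rep ℂ v₄ h₄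
  rw [crossRatio, ← ha, ← hb, ← hc, ← hd]
  exact vecCrossRatio_smul a.ne_zero b.ne_zero c.ne_zero d.ne_zero _ _ _ _

theorem crossRatio_aff (a b c d : ℂ) :
    crossRatio (aff a) (aff b) (aff c) (aff d) = (a - b) * (c - d) / ((a - d) * (b - c)) := by
  rw [aff, aff, aff, aff, crossRatio_mk]
  simp [vecCrossRatio, area]

theorem crossRatio_infty (z : ℂ) : crossRatio infty (aff (-1)) (aff 0) (aff z) = z := by
  rw [aff, aff, aff, infty, crossRatio_mk]
  simp [vecCrossRatio, area]

theorem area_map (g : LinearMap.GeneralLinearGroup ℂ V2) :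
    ∃ d : ℂ, d ≠ 0 ∧ ∀ v w : V2, area (g • v) (g • w) = d * area v w := by
  have exp : ∀ u : V2, g • u = u 0 • (g • (![1, 0] : V2)) + u 1 • (g • (![0, 1] : V2)) := by
    intro u
    rw [← smul_comm g, ← smul_comm g, ← smul_add]
    congr 1
    ext i
    fin_cases i <;> simp
  have fml : ∀ v w : V2, area (g • v) (g • w)
      = area (g • (![1, 0] : V2)) (g • (![0, 1] : V2)) * area v w := by
    intro v w
    rw [exp v, exp w]
    simp only [area, Pi.add_apply, Pi.smul_apply, smul_eq_mul]
    ring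
  refine ⟨_, ?_, fml⟩
  intro h0
  have h := fml (g⁻¹ • (![1, 0] : V2)) (g⁻¹ • (![0, 1] : V2))
  rw [smul_inv_smul, smul_inv_smul, h0] at h
  simp [area] at h

theorem crossRatio_map (g : LinearMap.GeneralLinearGroup ℂ V2) (x₁ x₂ x₃ x₄ : P1) :
    crossRatio (g • x₁) (g • x₂) (g • x₃) (g • x₄) = crossRatio x₁ x₂ x₃ x₄ := by
  induction x₁ using Projectivization.ind with | h v₁ h₁ => ?_
  induction x₂ using Projectivization.ind with | h v₂ h₂ => ?_
  induction x₃ using Projectivization.ind with | h v₃ h₃ => ?_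
  induction x₄ using Projectivization.ind with | h v₄ h₄ => ?_
  obtain ⟨d, hd, h⟩ := area_map g
  simp only [Projectivization.smul_mk]
  rw [crossRatio_mk, crossRatio_mk]
  simp only [vecCrossRatio, h]
  rw [show d * area v₁ v₂ * (d * area v₃ v₄) = (d * d) * (area v₁ v₂ * area v₃ v₄) by ring,
    show d * area v₁ v₄ * (d * area v₂ v₃) = (d * d) * (area v₁ v₄ * area v₂ v₃) by ring]
  exact mul_div_mul_left _ _ (mul_ne_zero hd hd)

/-- The cross-ratio `r(x_i, x_j, x_k, x_l)` as a function on `M̄₀,₅`. -/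
def Mbar.crossRatio (i j k l : ZMod 5) (m : Mbar) : ℂ :=
  Quotient.lift (s := projEquiv)
    (fun x : StableConf => ModuliM05.crossRatio (x.1 i) (x.1 j) (x.1 k) (x.1 l))
    (by
      rintro x y ⟨g, hg⟩
      simp only [hg]
      exact (crossRatio_map g _ _ _ _).symm) m

/-- The function
`X_{a,b;c} = r(x_c, x_{c+1}, x_{c+2}, x_{c+3})^a * r(x_c, x_{c+2}, x_{c+3}, x_{c+4})^b`
on `M^cyc₀,₅`. It is used for `a ≤ 0 ≤ b`. Then the second factor has no pole on `M^cyc₀,₅`, and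
at a pole of `r(x_c, x_{c+1}, x_{c+2}, x_{c+3})`, where `x_c = x_{c+3}`, the first factor with
`a < 0` takes the value `0⁻¹ = 0` in Lean, which is the value there of the regular function
`r⁻¹`. -/
def Xfun (a b : ℤ) (c : ZMod 5) (m : Mcyc) : ℂ :=
  Mbar.crossRatio c (c + 1) (c + 2) (c + 3) m.1 ^ a *
    Mbar.crossRatio c (c + 2) (c + 3) (c + 4) m.1 ^ b

/-- The set of all functions `X_{a,b;c}` with integers `a ≤ 0`, `b ≥ 0`, and `c` modulo `5`. -/
def Xset : Set (Mcyc → ℂ) :=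
  {f | ∃ (a b : ℤ) (c : ZMod 5), a ≤ 0 ∧ 0 ≤ b ∧ f = Xfun a b c}

end ModuliM05

end

noncomputable section

namespace ModuliM05

/-! ### Areas and cyclic configurations -/

theorem area_antisymm (v w : V2) : area v w = -area w v := by
  simp only [area]; ring

theorem area_plucker (v₁ v₂ v₃ v₄ : V2) :
    area v₁ v₃ * area v₂ v₄ = area v₁ v₂ * area v₃ v₄ + area v₁ v₄ * area v₂ v₃ := by
  simp only [area]; ring

theorem area_eq_zero_iff {v w : V2} (hv : v ≠ 0) (hw : w ≠ 0) :
    area v w = 0 ↔ Projectivization.mk ℂ v hv = Projectivization.mk ℂ w hw := by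
  rw [Projectivization.mk_eq_mk_iff']
  constructor
  · intro h
    have h' : v 0 * w 1 = w 0 * v 1 := sub_eq_zero.1 h
    by_cases h0 : w 0 = 0
    · have h1 : w 1 ≠ 0 := fun h1 => hw (by ext i; fin_cases i <;> assumption)
      have hv0 : v 0 = 0 := by simpa [h0, h1] using h'
      refine ⟨v 1 / w 1, ?_⟩
      ext i
      fin_cases i
      · simp [h0, hv0]
      · simp [h1]
    · refine ⟨v 0 / w 0, ?_⟩
      ext i
      fin_cases i
      · simp [h0]
      · simp only [Pi.smul_apply, smul_eq_mul, Fin.mk_one]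
        field_simp
        linear_combination h'
  · rintro ⟨a, rfl⟩
    simp only [area, Pi.smul_apply, smul_eq_mul]
    ring

/-- The area spanned by the `i`-th and the `j`-th vector. -/
abbrev HomCoord.area (v : HomCoord) (i j : ZMod 5) : ℂ := ModuliM05.area (v.vec i) (v.vec j)

theorem HomCoord.toMbar_surjective : Function.Surjective HomCoord.toMbar := by
  intro m
  obtain ⟨x, rfl⟩ : ∃ x, Mbar.mk x = m := Quotient.exists_rep m
  refine ⟨⟨fun i => (x.1 i).rep, fun i => (x.1 i).rep_nonzero, ?_⟩, ?_⟩
  · simpa using x.2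
  · simp [HomCoord.toMbar]

theorem mk_mem_boundaryDivisor {x : StableConf} {i j : ZMod 5} :
    Mbar.mk x ∈ boundaryDivisor i j ↔ x.1 i = x.1 j := by
  constructor
  · rintro ⟨y, hy, hij⟩
    obtain ⟨g, hg⟩ : projEquiv.r y x := Quotient.exact hy
    rw [hg, hg, hij]
  · exact fun h => ⟨x, rfl, h⟩

theorem mk_mem_Mcyc {x : StableConf} : Mbar.mk x ∈ Mcyc ↔ ∀ i, x.1 i ≠ x.1 (i + 1) := by
  simp [Mcyc, mk_mem_boundaryDivisor]

theorem HomCoord.toMbar_mem_Mcyc {v : HomCoord} :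
    v.toMbar ∈ Mcyc ↔ ∀ i, v.area i (i + 1) ≠ 0 := by
  rw [HomCoord.toMbar, mk_mem_Mcyc]
  exact forall_congr' fun i => (area_eq_zero_iff (v.ne_zero _) (v.ne_zero _)).not.symm

theorem HomCoord.crossRatio_toMbar (v : HomCoord) (i j k l : ZMod 5) :
    v.toMbar.crossRatio i j k l
      = (v.area i j * v.area k l) / (v.area i l * v.area j k) :=
  crossRatio_mk _ _ _ _

/-! ### The dihedral coordinates -/

/-- The cross-ratio `r(x_c, x_{c+2}, x_{c+3}, x_{c+4})`. -/
def dihedral (c : ZMod 5) (m : Mbar) : ℂ := m.crossRatio c (c + 2) (c + 3) (c + 4)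

theorem zmod_arith (c : ZMod 5) :
    c + 4 + 1 = c ∧ c + 3 + 1 = c + 4 ∧ c + 2 + 1 = c + 3 ∧ c + 1 + 1 = c + 2 ∧
    c + 1 + 2 = c + 3 ∧ c + 1 + 3 = c + 4 ∧ c + 1 + 4 = c ∧
    c + 3 + 2 = c ∧ c + 3 + 3 = c + 1 ∧ c + 3 + 4 = c + 2 := by
  revert c; decide

theorem cyclic_areas {v : HomCoord} (h : v.toMbar ∈ Mcyc) (c : ZMod 5) :
    v.area c (c + 1) ≠ 0 ∧ v.area (c + 1) (c + 2) ≠ 0 ∧ v.area (c + 2) (c + 3) ≠ 0 ∧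
      v.area (c + 3) (c + 4) ≠ 0 ∧ v.area (c + 4) c ≠ 0 := by
  obtain ⟨e1, e2, e3, e4, -⟩ := zmod_arith c
  rw [HomCoord.toMbar_mem_Mcyc] at h
  refine ⟨h c, ?_, ?_, ?_, ?_⟩
  · simpa only [e4] using h (c + 1)
  · simpa only [e3] using h (c + 2)
  · simpa only [e2] using h (c + 3)
  · simpa only [e1] using h (c + 4)

theorem dihedral_toMbar (c : ZMod 5) (v : HomCoord) : dihedral c v.toMbar
    = v.area c (c + 2) * v.area (c + 3) (c + 4) / (v.area c (c + 4) * v.area (c + 2) (c + 3)) :=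
  v.crossRatio_toMbar _ _ _ _

theorem dihedral_ne_zero_iff {v : HomCoord} (h : v.toMbar ∈ Mcyc) (c : ZMod 5) :
    dihedral c v.toMbar ≠ 0 ↔ v.area c (c + 2) ≠ 0 := by
  obtain ⟨h0, h1, h2, h3, h4⟩ := cyclic_areas h c
  have h4' : v.area c (c + 4) ≠ 0 := by
    rw [HomCoord.area, area_antisymm]; exact neg_ne_zero.2 h4
  rw [dihedral_toMbar]
  simp only [ne_eq, div_eq_zero_iff, mul_eq_zero, h2, h3, h4', or_false]

theorem dihedral_mul {m : Mbar} (h : m ∈ Mcyc) (c : ZMod 5) :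
    dihedral c m * dihedral (c + 1) m = 1 + dihedral (c + 3) m := by
  obtain ⟨v, rfl⟩ := HomCoord.toMbar_surjective m
  obtain ⟨h0, h1, h2, h3, h4⟩ := cyclic_areas h c
  obtain ⟨-, -, -, -, e1, e2, e3, e4, e5, e6⟩ := zmod_arith c
  simp only [dihedral_toMbar, e1, e2, e3, e4, e5, e6]
  simp only [HomCoord.area] at *
  have p := area_plucker (v.vec c) (v.vec (c + 1)) (v.vec (c + 2)) (v.vec (c + 3))
  rw [area_antisymm (v.vec c) (v.vec (c + 4)), area_antisymm (v.vec (c + 1)) (v.vec c),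
    area_antisymm (v.vec (c + 3)) (v.vec (c + 2)), area_antisymm (v.vec (c + 3)) (v.vec c)]
  field_simp
  linear_combination p

theorem crossRatio_inv {m : Mbar} (c : ZMod 5) :
    (m.crossRatio c (c + 1) (c + 2) (c + 3))⁻¹ = dihedral (c + 3) m := by
  obtain ⟨v, rfl⟩ := HomCoord.toMbar_surjective m
  obtain ⟨-, -, -, -, e1, e2, e3, e4, e5, e6⟩ := zmod_arith c
  rw [dihedral_toMbar, v.crossRatio_toMbar, inv_div]
  simp only [e4, e5, e6, HomCoord.area]
  rw [area_antisymm (v.vec (c + 3)) (v.vec (c + 2)), area_antisymm (v.vec (c + 3)) (v.vec c)]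
  rw [neg_mul, neg_mul, neg_div_neg_eq, mul_comm (area (v.vec c) (v.vec (c + 1)))]

theorem Xfun_eq (a b : ℕ) (c : ZMod 5) (m : Mcyc) :
    Xfun (-a) b c m = dihedral (c + 3) m.1 ^ a * dihedral c m.1 ^ b := by
  rw [Xfun, zpow_neg, ← inv_zpow, crossRatio_inv]
  simp [dihedral]

/-! ### The affine pentagon surface -/

/-- The equations of the image of the dihedral coordinates. -/
def IsPentagon (a : ZMod 5 → ℂ) : Prop := ∀ c, a c * a (c + 1) = 1 + a (c + 3)

theorem isPentagon_dihedral (m : Mcyc) : IsPentagon fun c => dihedral c m.1 :=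
  fun c => dihedral_mul m.2 c

theorem IsPentagon.eqs {a : ZMod 5 → ℂ} (h : IsPentagon a) :
    a 0 * a 1 = 1 + a 3 ∧ a 1 * a 2 = 1 + a 4 ∧ a 2 * a 3 = 1 + a 0 ∧ a 3 * a 4 = 1 + a 1 ∧
      a 4 * a 0 = 1 + a 2 :=
  ⟨h 0, h 1, h 2, h 3, h 4⟩

/-- The five vectors with dihedral coordinates `a`. -/
def pentagonVec (a : ZMod 5 → ℂ) : ZMod 5 → V2 :=
  ![![-a 0, 1], ![1, 0], ![0, 1], ![-1, a 1], ![-a 2, a 4]]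

theorem pentagonVec_area {a : ZMod 5 → ℂ} (h : IsPentagon a) (i : ZMod 5) :
    area (pentagonVec a i) (pentagonVec a (i + 1)) ≠ 0 := by
  obtain ⟨h0, h1, h2, h3, h4⟩ := h.eqs
  change Fin 5 at i
  fin_cases i
  · change -a 0 * 0 - 1 * 1 ≠ 0
    simp
  · change (1 : ℂ) * 1 - 0 * 0 ≠ 0
    simp
  · change (0 : ℂ) * a 1 - -1 * 1 ≠ 0
    simp
  · change -1 * a 4 - -a 2 * a 1 ≠ 0
    rw [show -1 * a 4 - -a 2 * a 1 = 1 by linear_combination h1]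
    simp
  · change -a 2 * 1 - -a 0 * a 4 ≠ 0
    rw [show -a 2 * 1 - -a 0 * a 4 = 1 by linear_combination h4]
    simp

/-- The vectors with dihedral coordinates `a`, as homogeneous coordinates. -/
def pentagonCoord (a : ZMod 5 → ℂ) (h : IsPentagon a) : HomCoord where
  vec := pentagonVec a
  ne_zero i h0 := pentagonVec_area h i (by simp [h0, area])
  stable := isStable_of_cyclic fun i => by
    rw [ne_eq, ← area_eq_zero_iff]
    exact pentagonVec_area h i

theorem pentagonCoord_mem {a : ZMod 5 → ℂ} (h : IsPentagon a) :
    (pentagonCoord a h).toMbar ∈ Mcyc :=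
  HomCoord.toMbar_mem_Mcyc.2 (pentagonVec_area h)

theorem pentagonVec_zero (a : ZMod 5 → ℂ) : pentagonVec a 0 = ![-a 0, 1] := rfl

theorem pentagonVec_one (a : ZMod 5 → ℂ) : pentagonVec a 1 = ![1, 0] := rfl

theorem pentagonVec_two (a : ZMod 5 → ℂ) : pentagonVec a 2 = ![0, 1] := rfl

theorem pentagonVec_three (a : ZMod 5 → ℂ) : pentagonVec a 3 = ![-1, a 1] := rfl

theorem pentagonVec_four (a : ZMod 5 → ℂ) : pentagonVec a 4 = ![-a 2, a 4] := rfl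

theorem dihedral_eq (v : HomCoord) :
    dihedral 0 v.toMbar = v.area 0 2 * v.area 3 4 / (v.area 0 4 * v.area 2 3) ∧
    dihedral 1 v.toMbar = v.area 1 3 * v.area 4 0 / (v.area 1 0 * v.area 3 4) ∧
    dihedral 2 v.toMbar = v.area 2 4 * v.area 0 1 / (v.area 2 1 * v.area 4 0) ∧
    dihedral 3 v.toMbar = v.area 3 0 * v.area 1 2 / (v.area 3 2 * v.area 0 1) ∧
    dihedral 4 v.toMbar = v.area 4 1 * v.area 2 3 / (v.area 4 3 * v.area 1 2) :=
  ⟨dihedral_toMbar 0 v, dihedral_toMbar 1 v, dihedral_toMbar 2 v, dihedral_toMbar 3 v,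
    dihedral_toMbar 4 v⟩

theorem dihedral_pentagonCoord {a : ZMod 5 → ℂ} (h : IsPentagon a) (c : ZMod 5) :
    dihedral c (pentagonCoord a h).toMbar = a c := by
  obtain ⟨h0, h1, h2, h3, h4⟩ := h.eqs
  obtain ⟨k0, k1, k2, k3, k4⟩ := dihedral_eq (pentagonCoord a h)
  simp only [HomCoord.area, pentagonCoord, pentagonVec_zero, pentagonVec_one, pentagonVec_two,
    pentagonVec_three, pentagonVec_four, area, Matrix.cons_val_zero, Matrix.cons_val_one,
    Matrix.cons_val_fin_one] at k0 k1 k2 k3 k4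
  change Fin 5 at c
  fin_cases c
  · refine k0.trans ?_
    rw [show -1 * a 4 - -a 2 * a 1 = 1 by linear_combination h1,
      show -a 0 * a 4 - -a 2 * 1 = -1 by linear_combination -h4]
    simp
    rfl
  · refine k1.trans ?_
    rw [show -1 * a 4 - -a 2 * a 1 = 1 by linear_combination h1,
      show -a 2 * 1 - -a 0 * a 4 = 1 by linear_combination h4]
    simp
    rfl
  · refine k2.trans ?_
    rw [show -a 2 * 1 - -a 0 * a 4 = 1 by linear_combination h4]
    simp
    rfl
  · refine k3.trans ?_
    rw [show -1 * 1 - -a 0 * a 1 = a 3 by linear_combination h0]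
    simp
    rfl
  · refine k4.trans ?_
    rw [show -a 2 * a 1 - -1 * a 4 = -1 by linear_combination -h1]
    simp
    rfl

/-- The linear map `v ↦ (α Δ(v, q), β Δ(p, v))`. -/
def areaMap (p q : V2) (α β : ℂ) : V2 →ₗ[ℂ] V2 :=
  LinearMap.pi ![
    { toFun := fun v => α * area v q
      map_add' := fun v w => by simp only [area, Pi.add_apply]; ring
      map_smul' := fun t v => by simp only [area, Pi.smul_apply, smul_eq_mul, RingHom.id_apply]; ring },
    { toFun := fun v => β * area p v
      map_add' := fun v w => by simp only [area, Pi.add_apply]; ring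
      map_smul' := fun t v => by simp only [area, Pi.smul_apply, smul_eq_mul, RingHom.id_apply]; ring }]

theorem areaMap_apply (p q : V2) (α β : ℂ) (v : V2) :
    areaMap p q α β v = ![α * area v q, β * area p v] := by
  ext i; fin_cases i <;> rfl

theorem areaMap_injective {p q : V2} {α β : ℂ} (hα : α ≠ 0) (hβ : β ≠ 0) (h : area p q ≠ 0) :
    Function.Injective (areaMap p q α β) := by
  rw [injective_iff_map_eq_zero]
  intro v hv
  rw [areaMap_apply] at hv
  have h0 : area v q = 0 := by simpa [hα] using congrFun hv 0
  have h1 : area p v = 0 := by simpa [hβ] using congrFun hv 1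
  ext i
  refine (mul_eq_zero.1 (?_ : area p q * v i = 0)).resolve_left h
  simp only [area] at *
  fin_cases i
  · simp only [Fin.zero_eta]
    linear_combination p 0 * h0 + q 0 * h1
  · simp only [Fin.mk_one]
    linear_combination p 1 * h0 + q 1 * h1

theorem HomCoord.toMbar_eq_of_area {v w : HomCoord} (g : V2 →ₗ[ℂ] V2)
    (hg : Function.Injective g) (h : ∀ i, ModuliM05.area (w.vec i) (g (v.vec i)) = 0) :
    v.toMbar = w.toMbar := by
  let e : V2 ≃ₗ[ℂ] V2 := LinearEquiv.ofInjectiveEndo g hg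
  refine Quotient.sound ⟨LinearMap.GeneralLinearGroup.ofLinearEquiv e, fun i => ?_⟩
  simp only [Projectivization.smul_mk]
  rw [← area_eq_zero_iff]
  exact h i

theorem pentagonCoord_dihedral (m : Mcyc) :
    (pentagonCoord _ (isPentagon_dihedral m)).toMbar = m.1 := by
  obtain ⟨m, hm⟩ := m
  obtain ⟨v, rfl⟩ := HomCoord.toMbar_surjective m
  symm
  have hc := HomCoord.toMbar_mem_Mcyc.1 hm
  have h0 : v.area 0 1 ≠ 0 := hc 0
  have h1 : v.area 1 2 ≠ 0 := hc 1
  have h2 : v.area 2 3 ≠ 0 := hc 2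
  have h3 : v.area 3 4 ≠ 0 := hc 3
  have h4 : v.area 4 0 ≠ 0 := hc 4
  refine HomCoord.toMbar_eq_of_area
    (areaMap (v.vec 1) (v.vec 2) (v.area 0 1 * v.area 3 4) (-(v.area 2 3 * v.area 4 0)))
    (areaMap_injective (mul_ne_zero h0 h3) (neg_ne_zero.2 (mul_ne_zero h2 h4)) h1) fun i => ?_
  obtain ⟨k0, k1, k2, -, k4⟩ := dihedral_eq v
  rw [HomCoord.area, HomCoord.area, HomCoord.area, HomCoord.area, area_antisymm (v.vec 0) (v.vec 4)]
    at k0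
  rw [HomCoord.area, HomCoord.area, HomCoord.area, HomCoord.area, area_antisymm (v.vec 1) (v.vec 0)]
    at k1
  rw [HomCoord.area, HomCoord.area, HomCoord.area, HomCoord.area, area_antisymm (v.vec 2) (v.vec 1)]
    at k2
  rw [HomCoord.area, HomCoord.area, HomCoord.area, HomCoord.area, area_antisymm (v.vec 4) (v.vec 3),
    area_antisymm (v.vec 4) (v.vec 1)] at k4
  rw [areaMap_apply]
  simp only [HomCoord.area] at h0 h1 h2 h3 h4 ⊢
  have self : ∀ x, area x x = 0 := fun x => by simp only [area]; ring
  change Fin 5 at i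
  fin_cases i
  · change -dihedral 0 v.toMbar * (_ * area (v.vec 1) (v.vec 0)) - _ * area (v.vec 0) _ * 1 = 0
    rw [k0, area_antisymm (v.vec 1) (v.vec 0)]
    field_simp
    ring
  · change 1 * (_ * area (v.vec 1) (v.vec 1)) - _ * 0 = 0
    rw [self]
    ring
  · change 0 * _ - _ * area (v.vec 2) (v.vec 2) * 1 = 0
    rw [self]
    ring
  · change -1 * (_ * area (v.vec 1) (v.vec 3)) - _ * area (v.vec 3) (v.vec 2)
      * dihedral 1 v.toMbar = 0
    rw [k1, area_antisymm (v.vec 3) (v.vec 2)]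
    field_simp
    ring
  · change -dihedral 2 v.toMbar * (_ * area (v.vec 1) (v.vec 4)) - _ * area (v.vec 4) (v.vec 2)
      * dihedral 4 v.toMbar = 0
    rw [k2, k4, area_antisymm (v.vec 4) (v.vec 2)]
    field_simp
    ring

theorem dihedral_injective {m m' : Mbar} (hm : m ∈ Mcyc) (hm' : m' ∈ Mcyc)
    (h : ∀ c, dihedral c m = dihedral c m') : m = m' := by
  have e := pentagonCoord_dihedral ⟨m, hm⟩
  have e' := pentagonCoord_dihedral ⟨m', hm'⟩
  simp only [h] at e
  exact e.symm.trans e'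

/-! ### The torus charts -/

theorem psi_mem_Mcyc (c : ZMod 5) (t : ℂˣ × ℂˣ) : psi c t ∈ Mcyc := by
  rw [psi, mk_mem_Mcyc]
  intro i
  have h := baseConf_cyclic t.1 t.2 (i - 2 * (c - 1))
  rwa [sub_add_eq_add_sub] at h

theorem dihedral_psi (c : ZMod 5) (t : ℂˣ × ℂˣ) : dihedral (2 * c - 1) (psi c t) = t.2 := by
  have e : 2 * c - 1 - 2 * (c - 1) = 1 ∧ 2 * c - 1 + 2 - 2 * (c - 1) = 3 ∧
      2 * c - 1 + 3 - 2 * (c - 1) = 4 ∧ 2 * c - 1 + 4 - 2 * (c - 1) = 0 := by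
    revert c; decide
  obtain ⟨e1, e2, e3, e4⟩ := e
  change crossRatio (baseConf t.1 t.2 (2 * c - 1 - 2 * (c - 1)))
    (baseConf t.1 t.2 (2 * c - 1 + 2 - 2 * (c - 1)))
    (baseConf t.1 t.2 (2 * c - 1 + 3 - 2 * (c - 1)))
    (baseConf t.1 t.2 (2 * c - 1 + 4 - 2 * (c - 1))) = t.2
  rw [e1, e2, e3, e4]
  change crossRatio infty (aff 0) (aff t.1) (aff (t.1 * (1 + t.2))) = t.2
  rw [aff, aff, aff, infty, crossRatio_mk]
  have := t.1.ne_zero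
  simp only [vecCrossRatio, area, Matrix.cons_val_zero, Matrix.cons_val_one,
    Matrix.cons_val_fin_one]
  field_simp
  ring

theorem dihedral_psi_add_three (c : ZMod 5) (t : ℂˣ × ℂˣ) :
    dihedral (2 * c - 1 + 3) (psi c t) = (t.1 : ℂ)⁻¹ := by
  have e : 2 * c - 1 + 3 - 2 * (c - 1) = 4 ∧ 2 * c - 1 + 3 + 2 - 2 * (c - 1) = 1 ∧
      2 * c - 1 + 3 + 3 - 2 * (c - 1) = 2 ∧ 2 * c - 1 + 3 + 4 - 2 * (c - 1) = 3 := by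
    revert c; decide
  obtain ⟨e1, e2, e3, e4⟩ := e
  change crossRatio (baseConf t.1 t.2 (2 * c - 1 + 3 - 2 * (c - 1)))
    (baseConf t.1 t.2 (2 * c - 1 + 3 + 2 - 2 * (c - 1)))
    (baseConf t.1 t.2 (2 * c - 1 + 3 + 3 - 2 * (c - 1)))
    (baseConf t.1 t.2 (2 * c - 1 + 3 + 4 - 2 * (c - 1))) = (t.1 : ℂ)⁻¹
  rw [e1, e2, e3, e4]
  change crossRatio (aff t.1) infty (aff (-1)) (aff 0) = (t.1 : ℂ)⁻¹
  rw [aff, aff, aff, infty, crossRatio_mk]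
  simp [vecCrossRatio, area]

theorem psi_injective (c : ZMod 5) : Function.Injective (psi c) := by
  intro s t h
  refine Prod.ext (Units.ext (inv_injective ?_)) (Units.ext ?_)
  · rw [← dihedral_psi_add_three, ← dihedral_psi_add_three, h]
  · rw [← dihedral_psi, ← dihedral_psi, h]

/-- A point of the pentagon surface is determined by two of its coordinates where these do not
vanish. -/
theorem IsPentagon.ext {a b : ZMod 5 → ℂ} (ha : IsPentagon a) (hb : IsPentagon b) (d : ZMod 5)
    (h0 : a d ≠ 0) (h3 : a (d + 3) ≠ 0) (e0 : a d = b d) (e3 : a (d + 3) = b (d + 3)) :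
    ∀ c, a c = b c := by
  obtain ⟨k1, -⟩ := zmod_arith d
  have i2 : d + 2 + 1 = d + 3 ∧ d + 2 + 3 = d ∧ d + 4 + 3 = d + 2 := by
    clear * -; revert d; decide
  obtain ⟨i2, i3, i4⟩ := i2
  have e1 : a (d + 1) = b (d + 1) := by
    have h := ha d
    rw [e0, e3, ← hb d] at h
    exact mul_left_cancel₀ (e0 ▸ h0) h
  have e2 : a (d + 2) = b (d + 2) := by
    have h := ha (d + 2)
    have h' := hb (d + 2)
    rw [i2, i3] at h h'
    rw [e3, e0, ← h'] at h
    exact mul_right_cancel₀ (e3 ▸ h3) h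
  have e4 : a (d + 4) = b (d + 4) := by
    have h := ha (d + 4)
    have h' := hb (d + 4)
    rw [k1, i4] at h h'
    rw [e0, e2, ← h'] at h
    exact mul_right_cancel₀ (e0 ▸ h0) h
  intro c
  have hc : c = d ∨ c = d + 1 ∨ c = d + 2 ∨ c = d + 3 ∨ c = d + 4 := by
    clear * -; revert c d; decide
  rcases hc with rfl | rfl | rfl | rfl | rfl <;> assumption

theorem mem_range_psi {c : ZMod 5} {m : Mbar} : m ∈ Set.range (psi c) ↔
    m ∈ Mcyc ∧ dihedral (2 * c - 1) m ≠ 0 ∧ dihedral (2 * c - 1 + 3) m ≠ 0 := by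
  constructor
  · rintro ⟨t, rfl⟩
    refine ⟨psi_mem_Mcyc c t, ?_, ?_⟩
    · rw [dihedral_psi]; exact t.2.ne_zero
    · rw [dihedral_psi_add_three]; exact inv_ne_zero t.1.ne_zero
  · rintro ⟨hm, h0, h3⟩
    let t : ℂˣ × ℂˣ := ((Units.mk0 _ h3)⁻¹, Units.mk0 _ h0)
    refine ⟨t, dihedral_injective (psi_mem_Mcyc c t) hm ?_⟩
    refine IsPentagon.ext (isPentagon_dihedral ⟨_, psi_mem_Mcyc c t⟩)
      (isPentagon_dihedral ⟨m, hm⟩) (2 * c - 1) ?_ ?_ ?_ ?_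
    · rw [dihedral_psi]; exact t.2.ne_zero
    · rw [dihedral_psi_add_three]; exact inv_ne_zero t.1.ne_zero
    · rw [dihedral_psi]; rfl
    · rw [dihedral_psi_add_three]
      simp [t]

theorem IsPentagon.exists_ne_zero {a : ZMod 5 → ℂ} (h : IsPentagon a) :
    ∃ c : ZMod 5, a (2 * c - 1) ≠ 0 ∧ a (2 * c - 1 + 3) ≠ 0 := by
  have key : ∃ d, a d ≠ 0 ∧ a (d + 3) ≠ 0 := by
    by_contra! H
    obtain ⟨h0, h1, h2, h3, h4⟩ := h.eqs
    have H0 : a 0 ≠ 0 → a 3 = 0 := H 0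
    have H1 : a 1 ≠ 0 → a 4 = 0 := H 1
    have H2 : a 2 ≠ 0 → a 0 = 0 := H 2
    have H3 : a 3 ≠ 0 → a 1 = 0 := H 3
    have H4 : a 4 ≠ 0 → a 2 = 0 := H 4
    by_cases k0 : a 0 = 0
    · have e3 : a 3 = -1 := by linear_combination -h0 + a 1 * k0
      have e2 : a 2 = -1 := by linear_combination -h4 + a 4 * k0
      have e1 := H3 (by simp [e3])
      have e4 : a 4 = -1 := by linear_combination -h3 - e1 + a 4 * e3
      have := H4 (by simp [e4])
      simp [this] at e2
    · have e3 := H0 k0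
      have e1 : a 1 = -1 := by linear_combination -h3 + a 4 * e3
      have e4 := H1 (by simp [e1])
      have e2 : a 2 = -1 := by linear_combination -h4 + a 0 * e4
      exact k0 (H2 (by simp [e2]))
  obtain ⟨d, hd⟩ := key
  refine ⟨3 * (d + 1), ?_⟩
  rwa [show 2 * (3 * (d + 1)) - 1 = d by clear * -; revert d; decide]

theorem Mcyc_eq_iUnion : Mcyc = ⋃ c : ZMod 5, Set.range (psi c) := by
  ext m
  simp only [Set.mem_iUnion, mem_range_psi]
  constructor
  · intro hm
    obtain ⟨c, hc⟩ := (isPentagon_dihedral ⟨m, hm⟩).exists_ne_zero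
    exact ⟨c, hm, hc⟩
  · rintro ⟨c, hm, -⟩
    exact hm

/-- The area of the `i`-th and the `j`-th vector, as a polynomial. -/
def areaPoly (i j : ZMod 5) : CoordPoly :=
  .X (i, 0) * .X (j, 1) - .X (j, 0) * .X (i, 1)

theorem HomCoord.eval_areaPoly (v : HomCoord) (i j : ZMod 5) :
    v.eval (areaPoly i j) = v.area i j := by
  simp [HomCoord.eval, areaPoly, ModuliM05.area]

theorem isOpen_range_psi (c : ZMod 5) : IsOpen (Set.range (psi c)) := by
  rw [isOpen_coinduced]
  refine TopologicalSpace.isOpen_generateFrom_of_mem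
    ⟨(∏ i, areaPoly i (i + 1)) * (areaPoly (2 * c - 1) (2 * c - 1 + 2) *
      areaPoly (2 * c - 1 + 3) (2 * c - 1 + 3 + 2)), ?_⟩
  ext v
  have hprod : v.eval ((∏ i, areaPoly i (i + 1)) * (areaPoly (2 * c - 1) (2 * c - 1 + 2) *
      areaPoly (2 * c - 1 + 3) (2 * c - 1 + 3 + 2)))
      = (∏ i, v.area i (i + 1)) * (v.area (2 * c - 1) (2 * c - 1 + 2) *
      v.area (2 * c - 1 + 3) (2 * c - 1 + 3 + 2)) := by
    simp only [← HomCoord.eval_areaPoly]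
    simp only [HomCoord.eval, map_mul, map_prod]
  simp only [Set.mem_preimage, mem_range_psi, Set.mem_ofPred_eq, hprod, mul_ne_zero_iff,
    Finset.prod_ne_zero_iff, Finset.mem_univ, true_imp_iff, ← HomCoord.toMbar_mem_Mcyc]
  exact and_congr_right fun h => by rw [dihedral_ne_zero_iff h, dihedral_ne_zero_iff h]

/-! ### Regular functions are polynomials in the dihedral coordinates -/

/-- A function on a Zariski closed subset of affine space that is locally a quotient of
polynomials is the restriction of a polynomial. -/
theorem exists_eval_eq_of_locally_div {σ : Type*} [Finite σ] {V : Set (σ → ℂ)}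
    (hV : ∀ a ∉ V, ∃ p : MvPolynomial σ ℂ, p.eval a ≠ 0 ∧ ∀ b ∈ V, p.eval b = 0)
    (F : (σ → ℂ) → ℂ)
    (hF : ∀ a ∈ V, ∃ p q : MvPolynomial σ ℂ, q.eval a ≠ 0 ∧
      ∀ b ∈ V, q.eval b ≠ 0 → F b = p.eval b / q.eval b) :
    ∃ P : MvPolynomial σ ℂ, ∀ a ∈ V, F a = P.eval a := by
  let J : Ideal (MvPolynomial σ ℂ) :=
    { carrier := {h | ∃ p : MvPolynomial σ ℂ, ∀ a ∈ V, h.eval a * F a = p.eval a}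
      zero_mem' := ⟨0, by simp⟩
      add_mem' := by
        rintro h h' ⟨p, hp⟩ ⟨p', hp'⟩
        exact ⟨p + p', fun a ha => by rw [map_add, map_add, add_mul, hp a ha, hp' a ha]⟩
      smul_mem' := by
        rintro g h ⟨p, hp⟩
        exact ⟨g * p, fun a ha => by rw [smul_eq_mul, map_mul, map_mul, mul_assoc, hp a ha]⟩ }
  have hJ : J = ⊤ := by
    by_contra hne
    obtain ⟨M, hM, hJM⟩ := Ideal.exists_le_maximal J hne
    obtain ⟨a, rfl⟩ := MvPolynomial.isMaximal_iff_eq_vanishingIdeal_singleton.1 hM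
    have key : ∀ h ∈ J, h.eval a = 0 := fun h hh =>
      (MvPolynomial.mem_vanishingIdeal_singleton_iff a h).1 (hJM hh)
    by_cases ha : a ∈ V
    · obtain ⟨p, q, hq, h⟩ := hF a ha
      have := key (q * q) ⟨p * q, fun b hb => by
        by_cases hqb : q.eval b = 0
        · simp [hqb]
        · rw [h b hb hqb, map_mul, map_mul]
          field_simp⟩
      simp [hq] at this
    · obtain ⟨p, hpa, hp⟩ := hV a ha
      exact hpa (key p ⟨0, fun b hb => by simp [hp b hb]⟩)
  obtain ⟨P, hP⟩ : (1 : MvPolynomial σ ℂ) ∈ J := hJ ▸ Submodule.mem_top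
  exact ⟨P, fun a ha => by simpa using hP a ha⟩

/-- The coordinates of the vectors `pentagonVec`, as polynomials. -/
def pentagonVecPoly : ZMod 5 → Fin 2 → MvPolynomial (ZMod 5) ℂ :=
  ![![-.X 0, 1], ![1, 0], ![0, 1], ![-1, .X 1], ![-.X 2, .X 4]]

theorem eval_pentagonVecPoly (a : ZMod 5 → ℂ) (i : ZMod 5) (j : Fin 2) :
    (pentagonVecPoly i j).eval a = pentagonVec a i j := by
  change Fin 5 at i
  fin_cases i <;> fin_cases j <;> simp [pentagonVecPoly, pentagonVec]

theorem eval_pentagonCoord {a : ZMod 5 → ℂ} (h : IsPentagon a) (p : CoordPoly) :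
    (pentagonCoord a h).eval p
      = (MvPolynomial.bind₁ (fun s => pentagonVecPoly s.1 s.2) p).eval a := by
  simp only [← MvPolynomial.aeval_eq_eval, MvPolynomial.aeval_bind₁, HomCoord.eval]
  simp only [MvPolynomial.aeval_eq_eval, eval_pentagonVecPoly]
  rfl

theorem exists_eval_dihedral {f : Mcyc → ℂ} (hf : IsRegularFun Mcyc f) :
    ∃ P : MvPolynomial (ZMod 5) ℂ, ∀ m : Mcyc, f m = P.eval fun c => dihedral c m.1 := by
  classical
  let F : (ZMod 5 → ℂ) → ℂ := fun a =>
    if h : IsPentagon a then f ⟨_, pentagonCoord_mem h⟩ else 0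
  obtain ⟨P, hP⟩ := exists_eval_eq_of_locally_div (V := {a | IsPentagon a}) (by
      intro a ha
      obtain ⟨c, hc⟩ : ∃ c, ¬ a c * a (c + 1) = 1 + a (c + 3) := not_forall.1 ha
      refine ⟨.X c * .X (c + 1) - (1 + .X (c + 3)), ?_, fun b hb => ?_⟩
      · simpa [sub_eq_zero] using hc
      · simpa [sub_eq_zero] using hb c) F (by
      intro a ha
      obtain ⟨p, q, hq, h⟩ := hf (pentagonCoord a ha) (pentagonCoord_mem ha)
      refine ⟨MvPolynomial.bind₁ (fun s => pentagonVecPoly s.1 s.2) p,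
        MvPolynomial.bind₁ (fun s => pentagonVecPoly s.1 s.2) q, ?_, fun b hb hqb => ?_⟩
      · rwa [← eval_pentagonCoord ha]
      · rw [← eval_pentagonCoord hb] at hqb
        rw [← eval_pentagonCoord hb, ← eval_pentagonCoord hb, ← h _ (pentagonCoord_mem hb) hqb]
        exact dif_pos hb)
  refine ⟨P, fun m => ?_⟩
  rw [← hP _ (isPentagon_dihedral m)]
  refine Eq.trans ?_ (dif_pos (isPentagon_dihedral m)).symm
  congr 1
  exact Subtype.ext (pentagonCoord_dihedral m).symm

/-! ### Products of compatible dihedral coordinates -/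

/-- The dihedral coordinate as a function on `Mcyc`. -/
def dihedralFun (c : ZMod 5) : Mcyc → ℂ := fun m => dihedral c m.1

theorem dihedralFun_mem (c : ZMod 5) : dihedralFun c ∈ regularFunctions Mcyc := by
  intro v hv
  have eval_mul : ∀ (w : HomCoord) (p q : CoordPoly), w.eval (p * q) = w.eval p * w.eval q :=
    fun w p q => by simp [HomCoord.eval]
  refine ⟨areaPoly c (c + 2) * areaPoly (c + 3) (c + 4),
    areaPoly c (c + 4) * areaPoly (c + 2) (c + 3), ?_, fun w hw _ => ?_⟩
  · obtain ⟨-, -, h2, -, h4⟩ := cyclic_areas hv c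
    rw [eval_mul, HomCoord.eval_areaPoly, HomCoord.eval_areaPoly]
    refine mul_ne_zero ?_ h2
    rw [HomCoord.area, area_antisymm]
    exact neg_ne_zero.2 h4
  · simp only [eval_mul, HomCoord.eval_areaPoly]
    exact dihedral_toMbar c w

theorem dihedralFun_mul (c : ZMod 5) :
    dihedralFun c * dihedralFun (c + 1) = 1 + dihedralFun (c + 3) :=
  funext fun m => dihedral_mul m.2 c

theorem Xset_eq : Xset = {f | ∃ (a b : ℕ) (c : ZMod 5),
    f = dihedralFun (c + 3) ^ a * dihedralFun c ^ b} := by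
  ext f
  constructor
  · rintro ⟨a, b, c, ha, hb, rfl⟩
    obtain ⟨a, rfl⟩ : ∃ n : ℕ, a = -n := ⟨a.natAbs, by omega⟩
    lift b to ℕ using hb
    exact ⟨a, b, c, funext fun m => Xfun_eq a b c m⟩
  · rintro ⟨a, b, c, rfl⟩
    exact ⟨-a, b, c, by omega, by omega, funext fun m => (Xfun_eq a b c m).symm⟩

theorem Xset_subset_regularFunctions : Xset ⊆ regularFunctions Mcyc := by
  rw [Xset_eq]
  rintro _ ⟨a, b, c, rfl⟩
  exact mul_mem (pow_mem (dihedralFun_mem _) _) (pow_mem (dihedralFun_mem _) _)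

theorem pow_mul_pow_mem_span (a b : ℕ) (c : ZMod 5) :
    dihedralFun (c + 3) ^ a * dihedralFun c ^ b ∈ Submodule.span ℂ Xset :=
  Submodule.subset_span (by rw [Xset_eq]; exact ⟨a, b, c, rfl⟩)

theorem dihedralFun_mul_mem_span (a b : ℕ) (c j : ZMod 5) :
    dihedralFun j * (dihedralFun (c + 3) ^ a * dihedralFun c ^ b) ∈ Submodule.span ℂ Xset := by
  have i : c + 3 + 3 = c + 1 ∧ c + 2 + 3 = c ∧ c + 2 + 1 = c + 3 ∧ c + 4 + 1 = c ∧
      c + 4 + 3 = c + 2 ∧ c + 3 + 1 = c + 4 := by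
    clear * -; revert c; decide
  obtain ⟨i1, i2, i3, i4, i5, i6⟩ := i
  have s1 : ∀ a b : ℕ, dihedralFun (c + 1) * (dihedralFun (c + 3) ^ a * dihedralFun c ^ b)
      ∈ Submodule.span ℂ Xset := by
    intro a b
    rcases b with _ | b
    · have h := pow_mul_pow_mem_span 1 a (c + 3)
      rw [i1] at h
      simpa using h
    · convert add_mem (pow_mul_pow_mem_span a b c) (pow_mul_pow_mem_span (a + 1) b c) using 1
      linear_combination (dihedralFun (c + 3) ^ a * dihedralFun c ^ b) * dihedralFun_mul c
  have s2 : ∀ a b : ℕ, dihedralFun (c + 2) * (dihedralFun (c + 3) ^ a * dihedralFun c ^ b)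
      ∈ Submodule.span ℂ Xset := by
    intro a b
    rcases a with _ | a
    · have h := pow_mul_pow_mem_span b 1 (c + 2)
      rw [i2] at h
      simpa [mul_comm] using h
    · have h := dihedralFun_mul (c + 2)
      rw [i2, i3] at h
      convert add_mem (pow_mul_pow_mem_span a b c) (pow_mul_pow_mem_span a (b + 1) c) using 1
      linear_combination (dihedralFun (c + 3) ^ a * dihedralFun c ^ b) * h
  have hj : j = c ∨ j = c + 1 ∨ j = c + 2 ∨ j = c + 3 ∨ j = c + 4 := by
    clear * -; revert c j; decide
  rcases hj with rfl | rfl | rfl | rfl | rfl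
  · convert pow_mul_pow_mem_span a (b + 1) j using 1
    ring
  · exact s1 a b
  · exact s2 a b
  · convert pow_mul_pow_mem_span (a + 1) b c using 1
    ring
  · rcases b with _ | b
    · rcases a with _ | a
      · simpa using pow_mul_pow_mem_span 0 1 (c + 4)
      · have h := dihedralFun_mul (c + 3)
        rw [i6, i1] at h
        convert add_mem (pow_mul_pow_mem_span a 0 c) (s1 a 0) using 1
        linear_combination dihedralFun (c + 3) ^ a * h
    · have h := dihedralFun_mul (c + 4)
      rw [i4, i5] at h
      convert add_mem (pow_mul_pow_mem_span a b c) (s2 a b) using 1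
      linear_combination (dihedralFun (c + 3) ^ a * dihedralFun c ^ b) * h

theorem mul_dihedralFun_mem_span {f : Mcyc → ℂ} (hf : f ∈ Submodule.span ℂ Xset) (j : ZMod 5) :
    f * dihedralFun j ∈ Submodule.span ℂ Xset := by
  induction hf using Submodule.span_induction with
  | mem f hf =>
    rw [Xset_eq] at hf
    obtain ⟨a, b, c, rfl⟩ := hf
    rw [mul_comm]
    exact dihedralFun_mul_mem_span a b c j
  | zero => rw [zero_mul]; exact zero_mem _
  | add f g _ _ hf hg => rw [add_mul]; exact add_mem hf hg
  | smul t f _ hf => rw [smul_mul_assoc]; exact Submodule.smul_mem _ _ hf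

theorem regularFunctions_le_span {f : Mcyc → ℂ} (hf : f ∈ regularFunctions Mcyc) :
    f ∈ Submodule.span ℂ Xset := by
  obtain ⟨P, hP⟩ := exists_eval_dihedral hf
  obtain rfl : f = fun m => P.eval fun c => dihedral c m.1 := funext hP
  clear hf hP
  induction P using MvPolynomial.induction_on with
  | C t =>
    convert Submodule.smul_mem _ t (pow_mul_pow_mem_span 0 0 0) using 1
    ext m
    simp
  | add p q hp hq =>
    simp only [map_add]
    exact add_mem hp hq
  | mul_X p j hp =>
    simp only [map_mul, MvPolynomial.eval_X]
    exact mul_dihedralFun_mem_span hp j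

/-! ### Linear independence -/

/-- Functions with distinct pole orders at the origin are linearly independent. -/
theorem eq_zero_of_sum_zpow_eq_zero {ι : Type*} {S : Finset ι} {g : ι → ℂ} {E : ι → ℤ}
    (hE : Set.InjOn E S) {Q : ι → ℂ → ℂ} (hQ : ∀ i, Continuous (Q i)) (hQ0 : ∀ i, Q i 0 = 1)
    (h : ∀ s : ℂ, s ≠ 0 → ∑ i ∈ S, g i * (s ^ (-E i) * Q i s) = 0) : ∀ i ∈ S, g i = 0 := by
  by_contra! H
  obtain ⟨i₀, hi₀, hg₀⟩ := H
  classical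
  obtain ⟨k, hk, hmax⟩ := (S.filter (g · ≠ 0)).exists_max_image E
    ⟨i₀, Finset.mem_filter.2 ⟨hi₀, hg₀⟩⟩
  obtain ⟨hkS, hgk⟩ := Finset.mem_filter.1 hk
  let H : ℂ → ℂ := fun s => ∑ i ∈ S, g i * (s ^ (E k - E i).toNat * Q i s)
  have hH : Continuous H := by
    refine continuous_finsetSum _ fun i _ => ?_
    have := hQ i
    fun_prop
  have hHz : H = fun _ => 0 := by
    refine hH.ext_on (dense_compl_singleton 0) continuous_const fun s hs => ?_
    have hs : s ≠ 0 := hs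
    have := h s hs
    calc H s = s ^ E k * ∑ i ∈ S, g i * (s ^ (-E i) * Q i s) := by
          rw [Finset.mul_sum]
          refine Finset.sum_congr rfl fun i hi => ?_
          by_cases hgi : g i = 0
          · simp [hgi]
          · have hle := hmax i (Finset.mem_filter.2 ⟨hi, hgi⟩)
            have : s ^ (E k - E i).toNat = s ^ E k * s ^ (-E i) := by
              rw [← zpow_add₀ hs, ← zpow_natCast]
              congr 1
              omega
            rw [this]
            ring
      _ = 0 := by rw [this, mul_zero]
  have hH0 : H 0 = g k := by
    change ∑ i ∈ S, g i * (0 ^ (E k - E i).toNat * Q i 0) = g k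
    rw [Finset.sum_eq_single_of_mem k hkS]
    · simp [hQ0]
    · intro i hi hik
      by_cases hgi : g i = 0
      · simp [hgi]
      · have hle := hmax i (Finset.mem_filter.2 ⟨hi, hgi⟩)
        have hne : E i ≠ E k := fun e => hik (hE hi hkS e)
        rw [zero_pow (by omega)]
        ring
  rw [hHz] at hH0
  exact hgk hH0.symm

/-- A weight that separates finitely many lattice vectors. -/
theorem exists_injOn_weight (S : Finset (ℤ × ℤ)) :
    ∃ N : ℕ, N ≠ 0 ∧ Set.InjOn (fun g : ℤ × ℤ => N * g.1 - g.2) S := by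
  refine ⟨2 * ∑ g ∈ S, g.2.natAbs + 1, by omega, ?_⟩
  rintro ⟨p, q⟩ hg ⟨p', q'⟩ hg' h
  have hq : q.natAbs ≤ ∑ g ∈ S, g.2.natAbs :=
    Finset.single_le_sum (f := fun g : ℤ × ℤ => g.2.natAbs) (fun _ _ => Nat.zero_le _) hg
  have hq' : q'.natAbs ≤ ∑ g ∈ S, g.2.natAbs :=
    Finset.single_le_sum (f := fun g : ℤ × ℤ => g.2.natAbs) (fun _ _ => Nat.zero_le _) hg'
  generalize ∑ g ∈ S, g.2.natAbs = B at *
  simp only at h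
  have hz : q - q' = 0 := by
    refine Int.eq_zero_of_abs_lt_dvd (m := ((2 * B + 1 : ℕ) : ℤ)) ⟨p - p', ?_⟩ ?_
    · linear_combination -h
    · rw [abs_lt]; constructor <;> omega
  have hp : ((2 * B + 1 : ℕ) : ℤ) * (p - p') = 0 := by linear_combination h + hz
  have hp' : p - p' = 0 := (mul_eq_zero.1 hp).resolve_left (by omega)
  exact Prod.ext (by simpa [sub_eq_zero] using hp') (by simpa [sub_eq_zero] using hz)

/-- The product of compatible dihedral coordinates with leading exponent `g`. -/
def clusterMonomial (g : ℤ × ℤ) : Mcyc → ℂ :=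
  dihedralFun 0 ^ min g.1.toNat (-g.2).toNat * dihedralFun 1 ^ g.2.toNat *
    dihedralFun 2 ^ ((-g.2).toNat - g.1.toNat) * dihedralFun 3 ^ (g.1.toNat - (-g.2).toNat) *
    dihedralFun 4 ^ (-g.1).toNat

theorem clusterMonomial_eq {p q : ℤ} {n₀ n₁ n₂ n₃ n₄ : ℕ} (h₀ : min p.toNat (-q).toNat = n₀)
    (h₁ : q.toNat = n₁) (h₂ : (-q).toNat - p.toNat = n₂) (h₃ : p.toNat - (-q).toNat = n₃)
    (h₄ : (-p).toNat = n₄) :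
    clusterMonomial (p, q) = dihedralFun 0 ^ n₀ * dihedralFun 1 ^ n₁ * dihedralFun 2 ^ n₂ *
      dihedralFun 3 ^ n₃ * dihedralFun 4 ^ n₄ := by
  subst h₀ h₁ h₂ h₃ h₄
  rfl

theorem Xset_subset_range_clusterMonomial : Xset ⊆ Set.range clusterMonomial := by
  rw [Xset_eq]
  rintro _ ⟨a, b, c, rfl⟩
  change Fin 5 at c
  fin_cases c
  · refine ⟨(a + b, -b), ?_⟩
    rw [clusterMonomial_eq (n₀ := b) (n₁ := 0) (n₂ := 0) (n₃ := a) (n₄ := 0) (by omega) (by omega)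
      (by omega) (by omega) (by omega)]
    change _ = dihedralFun 3 ^ a * dihedralFun 0 ^ b
    ring
  · refine ⟨(-a, b), ?_⟩
    rw [clusterMonomial_eq (n₀ := 0) (n₁ := b) (n₂ := 0) (n₃ := 0) (n₄ := a) (by omega) (by omega)
      (by omega) (by omega) (by omega)]
    change _ = dihedralFun 4 ^ a * dihedralFun 1 ^ b
    ring
  · refine ⟨(a, -a - b), ?_⟩
    rw [clusterMonomial_eq (n₀ := a) (n₁ := 0) (n₂ := b) (n₃ := 0) (n₄ := 0) (by omega) (by omega)
      (by omega) (by omega) (by omega)]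
    change _ = dihedralFun 0 ^ a * dihedralFun 2 ^ b
    ring
  · refine ⟨(b, a), ?_⟩
    rw [clusterMonomial_eq (n₀ := 0) (n₁ := a) (n₂ := 0) (n₃ := b) (n₄ := 0) (by omega) (by omega)
      (by omega) (by omega) (by omega)]
    change _ = dihedralFun 1 ^ a * dihedralFun 3 ^ b
    ring
  · refine ⟨(-b, -a), ?_⟩
    rw [clusterMonomial_eq (n₀ := 0) (n₁ := 0) (n₂ := a) (n₃ := 0) (n₄ := b) (by omega) (by omega)
      (by omega) (by omega) (by omega)]
    change _ = dihedralFun 2 ^ a * dihedralFun 4 ^ b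
    ring

theorem exists_mem_Mcyc {x y : ℂ} (hx : x ≠ 0) (hy : y ≠ 0) : ∃ m : Mcyc,
    dihedralFun 0 m = (1 + x) / y ∧ dihedralFun 1 m = y ∧ dihedralFun 2 m = (1 + x + y) / (x * y) ∧
      dihedralFun 3 m = x ∧ dihedralFun 4 m = (1 + y) / x := by
  let a : ZMod 5 → ℂ := ![(1 + x) / y, y, (1 + x + y) / (x * y), x, (1 + y) / x]
  have ha : IsPentagon a := by
    intro c
    change Fin 5 at c
    fin_cases c
    · change (1 + x) / y * y = 1 + x
      field_simp
    · change y * ((1 + x + y) / (x * y)) = 1 + (1 + y) / x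
      field_simp
      ring
    · change (1 + x + y) / (x * y) * x = 1 + (1 + x) / y
      field_simp
      ring
    · change x * ((1 + y) / x) = 1 + y
      field_simp
    · change (1 + y) / x * ((1 + x) / y) = 1 + (1 + x + y) / (x * y)
      field_simp
      ring
  have key := dihedral_pentagonCoord ha
  exact ⟨⟨_, pentagonCoord_mem ha⟩, key 0, key 1, key 2, key 3, key 4⟩

/-- The leading coefficient `1` power series of `clusterMonomial g` along the curve
`x = s⁻ᴺ`, `y = s`. -/
def clusterSeries (N : ℕ) (g : ℤ × ℤ) (s : ℂ) : ℂ :=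
  (1 + s ^ N) ^ min g.1.toNat (-g.2).toNat *
    (1 + s ^ N + s ^ (N + 1)) ^ ((-g.2).toNat - g.1.toNat) * (1 + s) ^ (-g.1).toNat

theorem clusterMonomial_curve (N : ℕ) {s : ℂ} (hs : s ≠ 0) : ∃ m : Mcyc, ∀ g : ℤ × ℤ,
    clusterMonomial g m = s ^ (-(N * g.1 - g.2)) * clusterSeries N g s := by
  obtain ⟨m, h0, h1, h2, h3, h4⟩ := exists_mem_Mcyc (inv_ne_zero (pow_ne_zero N hs)) hs
  refine ⟨m, fun g => ?_⟩
  have k0 : dihedralFun 0 m = s ^ (-(N + 1) : ℤ) * (1 + s ^ N) := by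
    rw [h0, zpow_neg, ← Nat.cast_succ, zpow_natCast, Nat.succ_eq_add_one, pow_succ]
    field_simp
    ring
  have k1 : dihedralFun 1 m = s ^ (1 : ℤ) := by rw [h1, zpow_one]
  have k2 : dihedralFun 2 m = s ^ (-1 : ℤ) * (1 + s ^ N + s ^ (N + 1)) := by
    rw [h2, zpow_neg_one, pow_succ]
    field_simp
    ring
  have k3 : dihedralFun 3 m = s ^ (-N : ℤ) := by rw [h3, zpow_neg, zpow_natCast]
  have k4 : dihedralFun 4 m = s ^ (N : ℤ) * (1 + s) := by
    rw [h4, zpow_natCast]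
    field_simp
  obtain ⟨p, q⟩ := g
  simp only [clusterMonomial, clusterSeries, Pi.mul_apply, Pi.pow_apply, k0, k1, k2, k3, k4,
    mul_pow]
  have hp : p = (min p.toNat (-q).toNat : ℕ) + (p.toNat - (-q).toNat : ℕ) - ((-p).toNat : ℕ) := by
    omega
  have hq : q = (q.toNat : ℕ) - ((-q).toNat - p.toNat : ℕ) - (min p.toNat (-q).toNat : ℕ) := by
    omega
  generalize min p.toNat (-q).toNat = n₀ at *
  generalize q.toNat = n₁ at *
  generalize (-q).toNat - p.toNat = n₂ at *
  generalize p.toNat - (-q).toNat = n₃ at *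
  generalize (-p).toNat = n₄ at *
  have hexp : s ^ (-(N * p - q)) = (s ^ (-(N + 1) : ℤ)) ^ n₀ * (s ^ (1 : ℤ)) ^ n₁ *
      (s ^ (-1 : ℤ)) ^ n₂ * (s ^ (-N : ℤ)) ^ n₃ * (s ^ (N : ℤ)) ^ n₄ := by
    simp only [← zpow_natCast, ← zpow_mul, ← zpow_add₀ hs]
    congr 1
    rw [hp, hq]
    ring
  rw [hexp]
  ring

theorem linearIndependent_clusterMonomial : LinearIndependent ℂ clusterMonomial := by
  rw [linearIndependent_iff']
  intro S g hg
  obtain ⟨N, hN, hinj⟩ := exists_injOn_weight S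
  refine eq_zero_of_sum_zpow_eq_zero hinj (Q := clusterSeries N) (fun i => ?_) (fun i => ?_)
    fun s hs => ?_
  · unfold clusterSeries
    fun_prop
  · simp [clusterSeries, hN]
  · obtain ⟨m, hm⟩ := clusterMonomial_curve N hs
    simpa [hm] using congrFun hg m

theorem linearIndependent_Xset : LinearIndependent ℂ (Subtype.val : Xset → Mcyc → ℂ) :=
  linearIndependent_clusterMonomial.linearIndepOn_id.mono Xset_subset_range_clusterMonomial

/-- The functions `X_{a,b;c}` as a basis of the regular functions on `Mcyc`. -/
theorem exists_basis_Xset : ∃ B : Module.Basis Xset ℂ (regularFunctions Mcyc),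
    ∀ f : Xset, (B f : Mcyc → ℂ) = f := by
  let b : Xset → regularFunctions Mcyc := fun f => ⟨f, Xset_subset_regularFunctions f.2⟩
  let ι : regularFunctions Mcyc →ₗ[ℂ] (Mcyc → ℂ) := (regularFunctions Mcyc).val.toLinearMap
  have hb : LinearIndependent ℂ b := LinearIndependent.of_comp ι linearIndependent_Xset
  have hspan : ⊤ ≤ Submodule.span ℂ (Set.range b) := by
    intro f _
    have hf : ι f ∈ (Submodule.span ℂ (Set.range b)).map ι := by
      rw [Submodule.map_span, ← Set.range_comp]
      have : Set.range (ι ∘ b) = Xset := Subtype.range_val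
      rw [this]
      exact regularFunctions_le_span f.2
    obtain ⟨f', hf', e⟩ := hf
    rwa [← Subtype.val_injective e]
  exact ⟨Module.Basis.mk hb hspan, fun f => by rw [Module.Basis.mk_apply]⟩

end ModuliM05

end

theorem theorem3p2 :
    ((∀ c : ZMod 5, Function.Injective (ModuliM05.psi c) ∧ IsOpen (Set.range (ModuliM05.psi c))) ∧
      ModuliM05.Mcyc = ⋃ c : ZMod 5, Set.range (ModuliM05.psi c)) ∧
    (∃ B : Module.Basis ModuliM05.Xset ℂ (ModuliM05.regularFunctions ModuliM05.Mcyc),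
      ∀ f : ModuliM05.Xset, (B f : ModuliM05.Mcyc → ℂ) = f) :=
  ⟨⟨fun c => ⟨ModuliM05.psi_injective c, ModuliM05.isOpen_range_psi c⟩,
    ModuliM05.Mcyc_eq_iUnion⟩, ModuliM05.exists_basis_Xset⟩
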